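/- For an operator $T$ on a complex Hilbert space $H$ write $\operatorname{Re}T=\tfrac12(T+T^*)$. Let $C_2(H)$ be the set of all bounded operators $T$ on $H$ that have a unitary $2$-dilation, i.e. for which there are a Hilbert space $\mathcal H\supseteq H$ and a unitary operator $U$ on $\mathcal H$ with $T^n=2P_HU^n|_H$ for all $n\ge 1$, where $P_H$ is the orthogonal projection of $\mathcal H$ onto $H$. (Equivalently, the numerical radius $w(T)=\sup\{|\langle Tx,x\rangle|:\|x\|=1\}$ is at most $1$.) For $T_0,T_1\in C_2(H)$, $T_1$ is Harnack dominated by $T_0$ if there is a constant $c\ge 1$ such that $$\operatorname{Re}p(T_1)\le c^2\operatorname{Re}p(T_0)+(c^2-1)\operatorname{Re}p(0_H)$$ for every complex polynomial $p$ with $\operatorname{Re}p\ge 0$ on the closed unit disk; $T_0$ and $T_1$ are Harnack equivalent if each is Harnack dominated by the other. Let $\operatorname{shift}(a,b,c,d)$ be the operator on $\mathbb C^5$ whose matrix in the canonical basis has superdiagonal entries $a,b,c,d$, in this order, and zeros elsewhere, and let $S=\frac{1}{\cos(\pi/6)}\operatorname{shift}(1,1,1,1)$. **Theorem.** One has $1/\cos(\pi/6)=2/\sqrt3$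 and $w(S)=1$. If $T\in C_2(\mathbb C^5)$ is Harnack equivalent to $S$, then at least one of the following holds for some $\theta\in\mathbb R$: 1. $T=\frac{2}{\sqrt3}\operatorname{shift}(1,e^{i\theta},e^{-i\theta},1)$, and $T$ is unitarily equivalent to $S$ (that is, $T=U^*SU$ for some unitary $U$); 2. $T=\operatorname{shift}\bigl(-\sqrt3,\tfrac{1}{\sqrt2}e^{i\theta},\tfrac{1}{\sqrt2}e^{-i\theta},-\sqrt3\bigr)$, and $\|T\|>\|S\|$ in operator norm. In particular every such $T$ is nilpotent, with the same order of nilpotency as $S$. -/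

import Mathlib

open scoped InnerProductSpace ComplexStarModule

section HarnackParts

universe u

variable {H : Type u} [NormedAddCommGroup H] [InnerProductSpace ℂ H] [CompleteSpace H]

/-- The operator `T` on the Hilbert space `H` is a `ρ`-contraction: it has a unitary
`ρ`-dilation, that is, there are a Hilbert space `K` containing `H` (through the isometric
embedding `J`, so that `J†` is the orthogonal projection of `K` onto `H`) and a unitary operator
`U` on `K` such that `T ^ n` is `ρ` times the compression of `U ^ n` to `H` for all `n ≥ 1`. -/
def IsRhoContraction (ρ : ℝ) (T : H →L[ℂ] H) : Prop :=
  ∃ (K : Type u) (_ : NormedAddCommGroup K) (_ : InnerProductSpace ℂ K) (_ : CompleteSpace K)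
    (J : H →ₗᵢ[ℂ] K) (U : K →L[ℂ] K), U ∈ unitary (K →L[ℂ] K) ∧
    ∀ n : ℕ, 1 ≤ n → T ^ n = (ρ : ℂ) •
      ((ContinuousLinearMap.adjoint J.toContinuousLinearMap) ∘L (U ^ n) ∘L J.toContinuousLinearMap)

/-- The class `C_ρ(H)` of all `ρ`-contractions on `H`. -/
def rhoContractions (ρ : ℝ) (H : Type u) [NormedAddCommGroup H] [InnerProductSpace ℂ H]
    [CompleteSpace H] : Set (H →L[ℂ] H) :=
  {T | IsRhoContraction ρ T}

/-- `T₁` is Harnack dominated by `T₀` (in `C_ρ(H)`): for some constant `c ≥ 1` one has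
`Re p(T₁) ≤ c² Re p(T₀) + (c² - 1)(ρ - 1) Re p(0)` for every complex polynomial `p` whose real part
is nonnegative on the closed unit disk. Here `Re A = (A + A*) / 2` is the real part of an operator
(denoted `ℜ A`) and `≤` is the Loewner order. -/
def HarnackDominated (ρ : ℝ) (T₁ T₀ : H →L[ℂ] H) : Prop :=
  ∃ c : ℝ, 1 ≤ c ∧ ∀ p : Polynomial ℂ,
    (∀ z : ℂ, ‖z‖ ≤ 1 → 0 ≤ (p.eval z).re) →
    (ℜ (Polynomial.aeval T₁ p) : H →L[ℂ] H) ≤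
      c ^ 2 • (ℜ (Polynomial.aeval T₀ p) : H →L[ℂ] H) +
        ((c ^ 2 - 1) * (ρ - 1)) • (ℜ (Polynomial.aeval (0 : H →L[ℂ] H) p) : H →L[ℂ] H)

/-- The Harnack part of `T₀` in `C_ρ(H)`: all `ρ`-contractions that are Harnack equivalent
to `T₀`. -/
def harnackPart (ρ : ℝ) (T₀ : H →L[ℂ] H) : Set (H →L[ℂ] H) :=
  {T | T ∈ rhoContractions ρ H ∧ HarnackDominated ρ T T₀ ∧ HarnackDominated ρ T₀ T}

/-- The numerical radius `w(T) = sup {|⟨T x, x⟩| : ‖x‖ = 1}`. -/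
noncomputable def numericalRadius (T : H →L[ℂ] H) : ℝ :=
  sSup {r : ℝ | ∃ x : H, ‖x‖ = 1 ∧ r = ‖⟪T x, x⟫_ℂ‖}

end HarnackParts

/-- The operator on `ℂ⁵` whose matrix in the canonical basis has the entries `a, b, c, d` on the
superdiagonal and zeros elsewhere. -/
noncomputable def weightedShift (a b c d : ℂ) :
    EuclideanSpace ℂ (Fin 5) →L[ℂ] EuclideanSpace ℂ (Fin 5) :=
  Matrix.toEuclideanCLM (n := Fin 5) (𝕜 := ℂ)
    !![0, a, 0, 0, 0;
       0, 0, b, 0, 0;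
       0, 0, 0, c, 0;
       0, 0, 0, 0, d;
       0, 0, 0, 0, 0]

/-- The normalized truncated shift `S` of size five, with superdiagonal entries `1 / cos (π / 6)`. -/
noncomputable def truncatedShift : EuclideanSpace ℂ (Fin 5) →L[ℂ] EuclideanSpace ℂ (Fin 5) :=
  ((1 / Real.cos (Real.pi / 6) : ℝ) : ℂ) • weightedShift 1 1 1 1

/-! Harnack domination transfers kernels. Testing it on rotated Fejér polynomials gives `F_N(z,T) ≤
c² F_N(z,S)` for the operator Fejér sums, with `c` independent of `N` and `z`, and `F_N(z,T) ≥ 0`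
because `T` has a unitary 2-dilation. For `S` there is a polynomial curve `k(z)` on which the form
of `∑ (z̄ⁿSⁿ + zⁿS*ⁿ)` vanishes, so the form of `F_N(z,S)` at `k(z)` stays bounded in `N`, while at
a fixed `y` it is `O(N)`. By Cauchy–Schwarz `|⟨y, F_N(z,T) k(z)⟩|²` is `O(N)`. But a Fourier
coefficient of this function of `z` is `(N+1)L - D` with `L`, `D` free of `N`, so `L = 0`; this is
`HarnackDominated.fourier_coeff_eq_zero`. The seven equations `L = 0` telescope to a description of
`T` and `T*` on five vectors of `ℂ⁵`. The adjoint relations between them leave two quadratics, each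
with two roots, and only two of the four combinations are consistent: these are the two families
(`eq_weightedShift_of_recurrence`). -/

/-! ### Fejér kernels of operators. -/

section FejerSums

open Finset ContinuousLinearMap

variable {H : Type*} [NormedAddCommGroup H] [InnerProductSpace ℂ H]

/-- Positivity of the Fejér kernel of a contraction, with the square that bounds it from below. -/
theorem norm_sum_pow_sq_le_fejer (V : H →L[ℂ] H) (hV : ∀ x, ‖V x‖ ≤ ‖x‖) (x : H) (N : ℕ) :
    ‖∑ n ∈ range (N + 1), (V ^ n) x‖ ^ 2 ≤
      2 * (∑ n ∈ range (N + 1), ((N + 1 - n : ℝ) : ℂ) * ⟪x, (V ^ n) x⟫_ℂ).re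
        - (N + 1) * ‖x‖ ^ 2 := by
  induction N with
  | zero =>
    simp [← Complex.ofReal_pow]
    linarith
  | succ N ih =>
    set s := ∑ n ∈ range (N + 1), (V ^ n) x with hs
    -- From `N` to `N + 1` the right-hand side grows by `2 Re⟨x, x + V s⟩ - ‖x‖² = ‖x + V s‖² - ‖V
    -- s‖²`, and `‖V s‖ ≤ ‖s‖`.
    have h1 : ∑ n ∈ range (N + 1 + 1), (V ^ n) x = x + V s := by
      rw [sum_range_succ', hs, map_sum, add_comm]
      simp [pow_succ']
    have h2 : ∑ n ∈ range (N + 1 + 1), (((N + 1 : ℕ) + 1 - n : ℝ) : ℂ) * ⟪x, (V ^ n) x⟫_ℂ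
        = ∑ n ∈ range (N + 1), ((N + 1 - n : ℝ) : ℂ) * ⟪x, (V ^ n) x⟫_ℂ + ⟪x, x + V s⟫_ℂ := by
      rw [← h1, inner_sum, sum_range_succ _ (N + 1), sum_range_succ _ (N + 1), ← add_assoc,
        ← sum_add_distrib]
      congr 1
      · refine sum_congr rfl fun n _ => ?_
        push_cast; ring
      · push_cast; ring
    have h3 : (⟪x, x + V s⟫_ℂ).re = ‖x‖ ^ 2 + (⟪x, V s⟫_ℂ).re := by
      rw [inner_add_right, Complex.add_re]
      congr 1
      exact inner_self_eq_norm_sq (𝕜 := ℂ) x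
    have h4 : ‖x + V s‖ ^ 2 = ‖x‖ ^ 2 + 2 * (⟪x, V s⟫_ℂ).re + ‖V s‖ ^ 2 :=
      norm_add_sq (𝕜 := ℂ) x (V s)
    have h5 : ‖V s‖ ^ 2 ≤ ‖s‖ ^ 2 := by gcongr; exact hV s
    rw [h1, h2, Complex.add_re, h3, h4, Nat.cast_succ]
    linarith

/-- The Fejér polynomial of degree `N`, rotated by `z`, scaled to have constant term `N + 1`. -/
noncomputable def fejerPoly (N : ℕ) (z : ℂ) : Polynomial ℂ :=
  2 * ∑ n ∈ range (N + 1), Polynomial.C (((N + 1 - n : ℝ) : ℂ) * (starRingEnd ℂ z) ^ n) *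
    Polynomial.X ^ n - Polynomial.C ((N : ℂ) + 1)

theorem fejerPoly_re_nonneg (N : ℕ) {z : ℂ} (hz : ‖z‖ = 1) (w : ℂ) (hw : ‖w‖ ≤ 1) :
    0 ≤ ((fejerPoly N z).eval w).re := by
  -- The scalar case: multiplication by `z̄ w` is a contraction of `ℂ`.
  have h := norm_sum_pow_sq_le_fejer (H := ℂ) ((starRingEnd ℂ z * w) • (1 : ℂ →L[ℂ] ℂ))
    (fun x => by simpa [hz] using mul_le_of_le_one_left (norm_nonneg x) hw) 1 N
  refine (sq_nonneg _).trans (h.trans (le_of_eq ?_))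
  simp only [fejerPoly, Polynomial.eval_sub, Polynomial.eval_mul, Polynomial.eval_finsetSum,
    Polynomial.eval_C, Polynomial.eval_pow, Polynomial.eval_X, Complex.sub_re]
  have h2 : Polynomial.eval w (2 : Polynomial ℂ) = ((2 : ℝ) : ℂ) := by simp
  rw [h2, Complex.re_ofReal_mul]
  simp [smul_pow, mul_pow, mul_assoc]

theorem re_inner_le_of_le {A B : H →L[ℂ] H} (h : A ≤ B) (x : H) :
    (⟪x, A x⟫_ℂ).re ≤ (⟪x, B x⟫_ℂ).re := by
  have := (le_def A B).1 h |>.re_inner_nonneg_right x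
  simpa [inner_sub_right] using this

variable [CompleteSpace H]

/-- The unnormalised Fejér sum `∑ (N + 1 - n) (z̄ⁿ Aⁿ + zⁿ A*ⁿ)` over `0 ≤ n ≤ N`. -/
noncomputable def fejerSum (N : ℕ) (z : ℂ) (A : H →L[ℂ] H) : H →L[ℂ] H :=
  ∑ n ∈ range (N + 1), ((N + 1 - n : ℝ) : ℂ) •
    ((starRingEnd ℂ z) ^ n • A ^ n + z ^ n • (star A) ^ n)

theorem star_fejerSum (N : ℕ) (z : ℂ) (A : H →L[ℂ] H) :
    star (fejerSum N z A) = fejerSum N z A := by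
  simp only [fejerSum, star_sum, star_smul, star_add, star_pow, star_star]
  refine sum_congr rfl fun n _ => ?_
  rw [add_comm (star (starRingEnd ℂ z) ^ n • _)]
  simp

theorem realPart_aeval_fejerPoly (N : ℕ) (z : ℂ) (A : H →L[ℂ] H) :
    (ℜ (Polynomial.aeval A (fejerPoly N z)) : H →L[ℂ] H) =
      fejerSum N z A - (N + 1 : ℝ) • (1 : H →L[ℂ] H) := by
  set P := ∑ n ∈ range (N + 1), ((N + 1 - n : ℝ) : ℂ) • ((starRingEnd ℂ z) ^ n • A ^ n) with hP
  have h : Polynomial.aeval A (fejerPoly N z) = (2 : ℝ) • P - (N + 1 : ℝ) • (1 : H →L[ℂ] H) := by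
    simp only [fejerPoly, map_sub, map_mul, map_sum, Polynomial.aeval_C, map_pow,
      Polynomial.aeval_X, map_ofNat, hP]
    congr 1
    · simp only [two_smul, two_mul, Algebra.smul_def (R := ℂ), map_pow, mul_assoc]
    · ext x; simp [add_smul, Algebra.algebraMap_eq_smul_one, Nat.cast_smul_eq_nsmul]
  have h2 : fejerSum N z A = P + star P := by
    rw [hP, star_sum, ← sum_add_distrib]
    refine sum_congr rfl fun n _ => ?_
    rw [star_smul, star_smul, smul_add]
    simp
  rw [realPart_apply_coe, h, h2, star_sub, star_smul, star_smul, star_one,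
    star_trivial (2 : ℝ), star_trivial (N + 1 : ℝ)]
  module

theorem fejerSum_zero (N : ℕ) (z : ℂ) :
    fejerSum N z (0 : H →L[ℂ] H) = (2 * (N + 1) : ℝ) • (1 : H →L[ℂ] H) := by
  rw [fejerSum, sum_range_succ']
  ext x
  simp [two_mul, add_smul, Nat.cast_smul_eq_nsmul]

theorem re_inner_fejerSum (N : ℕ) (z : ℂ) (A : H →L[ℂ] H) (x : H) :
    (⟪x, fejerSum N z A x⟫_ℂ).re = 2 * ∑ n ∈ range (N + 1),
      (N + 1 - n : ℝ) * ((starRingEnd ℂ z) ^ n * ⟪x, (A ^ n) x⟫_ℂ).re := by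
  simp only [fejerSum, _root_.sum_apply, inner_sum, Complex.re_sum, mul_sum]
  refine sum_congr rfl fun n _ => ?_
  rw [smul_apply, inner_smul_right, Complex.re_ofReal_mul, add_apply, inner_add_right,
    smul_apply, smul_apply, inner_smul_right, inner_smul_right, Complex.add_re, ← star_pow,
    star_eq_adjoint, adjoint_inner_right, ← inner_conj_symm ((A ^ n) x) x]
  have : (z ^ n * (starRingEnd ℂ) ⟪x, (A ^ n) x⟫_ℂ).re
      = ((starRingEnd ℂ z) ^ n * ⟪x, (A ^ n) x⟫_ℂ).re := by
    rw [← Complex.conj_re]; simp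
  rw [this]; ring

end FejerSums

/-! ### Fejér sums under domination and dilation. -/

section Domination

open Finset ContinuousLinearMap

universe u
variable {H : Type u} [NormedAddCommGroup H] [InnerProductSpace ℂ H] [CompleteSpace H]

/-- For `ρ = 2` the multiples of the identity cancel: each real part is the Fejér sum minus `N + 1`,
and at the zero operator it equals `N + 1`. -/
theorem HarnackDominated.fejerSum_le {T S : H →L[ℂ] H} (h : HarnackDominated 2 T S) :
    ∃ c : ℝ, ∀ (N : ℕ) (z : ℂ), ‖z‖ = 1 → fejerSum N z T ≤ c ^ 2 • fejerSum N z S := by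
  obtain ⟨c, -, hc⟩ := h
  refine ⟨c, fun N z hz => ?_⟩
  have := hc (fejerPoly N z) (fejerPoly_re_nonneg N hz)
  rw [realPart_aeval_fejerPoly, realPart_aeval_fejerPoly, realPart_aeval_fejerPoly,
    fejerSum_zero, sub_le_iff_le_add] at this
  refine this.trans (le_of_eq ?_)
  match_scalars <;> ring

/-- The factor 2 in `Tⁿ = 2 J†UⁿJ` makes the sum twice the compression of the Fejér operator of the
contraction `z̄ U`, whose form is bounded below by a square. -/
theorem IsRhoContraction.fejerSum_nonneg {T : H →L[ℂ] H} (h : IsRhoContraction 2 T) (N : ℕ)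
    {z : ℂ} (hz : ‖z‖ = 1) : 0 ≤ fejerSum N z T := by
  obtain ⟨K, _, _, _, J, U, hU, hJ⟩ := h
  rw [nonneg_iff_isPositive, isPositive_iff_complex]
  intro x
  have him : (⟪fejerSum N z T x, x⟫_ℂ).im = 0 := by
    have h1 : ⟪fejerSum N z T x, x⟫_ℂ = ⟪x, fejerSum N z T x⟫_ℂ := by
      conv_lhs => rw [← star_fejerSum, star_eq_adjoint, adjoint_inner_left]
    rw [← Complex.conj_eq_iff_im, inner_conj_symm, h1]
  have hUn : ∀ y, ‖U y‖ = ‖y‖ := fun y => Unitary.norm_map ⟨U, hU⟩ y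
  have hf := norm_sum_pow_sq_le_fejer ((starRingEnd ℂ z) • U)
    (fun y => by simp [norm_smul, hz, hUn]) (J x) N
  have hre : (⟪x, fejerSum N z T x⟫_ℂ).re = 2 * (2 * (∑ n ∈ range (N + 1), ((N + 1 - n : ℝ) : ℂ) *
      ⟪J x, (((starRingEnd ℂ z) • U) ^ n) (J x)⟫_ℂ).re - (N + 1) * ‖J x‖ ^ 2) := by
    rw [re_inner_fejerSum, sum_range_succ', sum_range_succ' (fun n => ((N + 1 - n : ℝ) : ℂ) * _),
      Complex.add_re, Complex.re_sum]
    have h0 : (⟪x, x⟫_ℂ).re = ‖x‖ ^ 2 := inner_self_eq_norm_sq (𝕜 := ℂ) x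
    have h1 : ∀ n : ℕ, ((starRingEnd ℂ z) ^ (n + 1) * ⟪x, (T ^ (n + 1)) x⟫_ℂ).re =
        2 * (⟪J x, (((starRingEnd ℂ z) • U) ^ (n + 1)) (J x)⟫_ℂ).re := by
      intro n
      rw [hJ (n + 1) (by omega), smul_pow, smul_apply, smul_apply, inner_smul_right,
        inner_smul_right, comp_apply, comp_apply, adjoint_inner_right, mul_left_comm,
        Complex.re_ofReal_mul]
      rfl
    simp only [h1, Complex.re_ofReal_mul]
    simp only [pow_zero, one_apply_eq_self, one_mul, LinearIsometry.inner_map_map, h0,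
      LinearIsometry.norm_map]
    rw [mul_add, mul_sub, mul_add, mul_add]
    simp only [mul_sum]
    rw [sum_congr rfl fun n _ => show 2 * ((N + 1 - (n + 1 : ℕ) : ℝ) * (2 *
      (⟪J x, (((starRingEnd ℂ z) • U) ^ (n + 1)) (J x)⟫_ℂ).re)) = 2 * (2 *
      ((N + 1 - (n + 1 : ℕ) : ℝ) * (⟪J x, (((starRingEnd ℂ z) • U) ^ (n + 1)) (J x)⟫_ℂ).re)) by ring]
    push_cast
    ring
  have hnn : 0 ≤ (⟪fejerSum N z T x, x⟫_ℂ).re := by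
    rw [← inner_conj_symm, Complex.conj_re, hre]
    have := (sq_nonneg _).trans hf
    linarith
  exact ⟨Complex.ext rfl (by simpa using him.symm), hnn⟩

/-- The Cauchy–Schwarz inequality for the form of a positive operator. -/
theorem norm_inner_sq_le_of_nonneg {A : H →L[ℂ] H} (hA : 0 ≤ A) (x y : H) :
    ‖⟪y, A x⟫_ℂ‖ ^ 2 ≤ (⟪y, A y⟫_ℂ).re * (⟪x, A x⟫_ℂ).re := by
  obtain ⟨B, rfl⟩ := CStarAlgebra.nonneg_iff_eq_star_mul_self.1 hA
  have h : ∀ u v : H, ⟪u, (star B * B) v⟫_ℂ = ⟪B u, B v⟫_ℂ := fun u v => by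
    rw [star_eq_adjoint, mul_apply_eq_comp, adjoint_inner_right]
  have h2 : ∀ u : H, (⟪u, u⟫_ℂ).re = ‖u‖ ^ 2 := fun u => inner_self_eq_norm_sq (𝕜 := ℂ) u
  rw [h, h, h, h2, h2, ← mul_pow]
  gcongr
  exact norm_inner_le_norm _ _

end Domination

/-! ### Discrete Fourier coefficients and growth in `N`. -/

section FourierCoefficients

open Finset

theorem sum_rootsOfUnity_zpow {M : ℕ} {ζ : ℂ} (hζ : IsPrimitiveRoot ζ M) {a : ℤ} (ha : |a| < M) :
    ∑ k ∈ range M, (ζ ^ k) ^ a = if a = 0 then (M : ℂ) else 0 := by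
  split_ifs with h
  · simp [h]
  · have h1 : ∀ k : ℕ, (ζ ^ k) ^ a = (ζ ^ a) ^ k := fun k => by
      rw [← zpow_natCast, ← zpow_natCast, ← zpow_mul, ← zpow_mul, mul_comm]
    have h2 : ζ ^ a ≠ 1 := fun h3 =>
      h (Int.eq_zero_of_abs_lt_dvd ((hζ.zpow_eq_one_iff_dvd a).1 h3) ha)
    simp only [h1]
    rw [geom_sum_eq h2, ← h1, hζ.pow_eq_one, one_zpow, sub_self, zero_div]

/-- The coefficients of a Laurent polynomial are bounded by its supremum on the unit circle. -/
theorem norm_sum_filter_le_of_laurent_bound {ι : Type*} (s : Finset ι) (c : ι → ℂ) (e : ι → ℤ)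
    {B : ℝ} (h : ∀ z : ℂ, ‖z‖ = 1 → ‖∑ i ∈ s, c i * z ^ e i‖ ≤ B) (m : ℤ) :
    ‖∑ i ∈ s with e i = m, c i‖ ≤ B := by
  -- `M` exceeds every `|e i - m|`, so averaging over the `M`-th roots of unity isolates the
  -- exponent `m` without aliasing.
  set M : ℕ := ∑ i ∈ s, (e i - m).natAbs + 1 with hM
  have hM0 : M ≠ 0 := by omega
  have hζ := Complex.isPrimitiveRoot_exp M hM0
  set ζ := Complex.exp (2 * Real.pi * Complex.I / M)
  have hn : ∀ k : ℕ, ‖ζ ^ k‖ = 1 := fun k => by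
    rw [norm_pow, hζ.norm'_eq_one hM0, one_pow]
  have hbd : ∀ i ∈ s, |e i - m| < M := fun i hi => by
    have := single_le_sum (f := fun i => (e i - m).natAbs) (fun _ _ => Nat.zero_le _) hi
    rw [Int.abs_eq_natAbs]
    omega
  have key : ∑ k ∈ range M, (ζ ^ k) ^ (-m) * ∑ i ∈ s, c i * (ζ ^ k) ^ e i =
      M * ∑ i ∈ s with e i = m, c i := by
    simp only [mul_sum]
    rw [sum_comm, sum_filter]
    refine sum_congr rfl fun i hi => ?_
    have h0 : ∀ k ∈ range M, (ζ ^ k) ^ (-m) * (c i * (ζ ^ k) ^ e i) =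
        c i * (ζ ^ k) ^ (e i - m) := fun k _ => by
      have : ζ ^ k ≠ 0 := norm_ne_zero_iff.1 (by rw [hn]; exact one_ne_zero)
      rw [sub_eq_add_neg, zpow_add₀ this]; ring
    rw [sum_congr rfl h0, ← mul_sum, sum_rootsOfUnity_zpow hζ (hbd i hi)]
    simp only [sub_eq_zero]
    split_ifs <;> ring
  have hle : ‖(M : ℂ) * ∑ i ∈ s with e i = m, c i‖ ≤ M * B := by
    rw [← key]
    refine (norm_sum_le _ _).trans ((sum_le_card_nsmul _ _ B fun k _ => ?_).trans ?_)
    · rw [norm_mul, norm_zpow, hn, one_zpow, one_mul]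
      exact h _ (hn k)
    · simp
  rw [norm_mul, Complex.norm_natCast] at hle
  exact le_of_mul_le_mul_left hle (by positivity)

/-- If `L ≠ 0`, the left side grows like `N²` and overtakes the linear bound. -/
theorem eq_zero_of_norm_sq_le_linear (d : ℕ) (L D : ℂ) (K : ℝ)
    (h : ∀ N : ℕ, d ≤ N → ‖((N + 1 : ℝ) : ℂ) * L - D‖ ^ 2 ≤ K * (N + 1)) : L = 0 := by
  by_contra hL
  have hL' : 0 < ‖L‖ ^ 2 := by positivity
  obtain ⟨N, hN⟩ := exists_nat_gt (max (d : ℝ) (2 * (K + ‖D‖ ^ 2) / ‖L‖ ^ 2))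
  obtain ⟨h1, h2⟩ := max_lt_iff.1 hN
  have h3 := h N (by exact_mod_cast h1.le)
  rw [div_lt_iff₀ hL'] at h2
  have h4 : ‖((N + 1 : ℝ) : ℂ) * L‖ ≤ ‖((N + 1 : ℝ) : ℂ) * L - D‖ + ‖D‖ := by
    simpa using norm_add_le (((N + 1 : ℝ) : ℂ) * L - D) D
  have h5 : ‖((N + 1 : ℝ) : ℂ) * L‖ = (N + 1) * ‖L‖ := by
    rw [norm_mul, Complex.norm_real, Real.norm_of_nonneg (by positivity)]
  have h6 : ((N + 1) * ‖L‖) ^ 2 ≤ 2 * (K * (N + 1)) + 2 * ‖D‖ ^ 2 := by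
    rw [← h5]
    nlinarith [norm_nonneg (((N + 1 : ℝ) : ℂ) * L), sq_nonneg
      (‖((N + 1 : ℝ) : ℂ) * L - D‖ - ‖D‖)]
  have h7 : (0 : ℝ) ≤ N := N.cast_nonneg
  have h8 : ((N + 1) * ‖L‖) ^ 2 ≤ (N + 1) * (2 * (K + ‖D‖ ^ 2)) := by
    nlinarith [mul_nonneg h7 (sq_nonneg ‖D‖)]
  have h9 : (N + 1) * ‖L‖ ^ 2 ≤ 2 * (K + ‖D‖ ^ 2) := by
    refine le_of_mul_le_mul_left (a := (N + 1 : ℝ)) ?_ (by positivity)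
    calc _ = ((N + 1) * ‖L‖) ^ 2 := by ring
      _ ≤ _ := h8
  nlinarith

end FourierCoefficients

/-! ### Transfer of kernel curves. -/

section KernelCurve

open Finset ContinuousLinearMap

universe u
variable {H : Type u} [NormedAddCommGroup H] [InnerProductSpace ℂ H] [CompleteSpace H]

theorem sum_range_eq_of_forall_ge {E : Type*} [AddCommMonoid E] {f : ℕ → E} {d n : ℕ}
    (hf : ∀ i, d ≤ i → f i = 0) (hn : d ≤ n) : ∑ i ∈ range n, f i = ∑ i ∈ range d, f i :=
  (sum_subset (range_subset_range.2 hn) fun i _ hi => hf i (by simpa using hi)).symm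

/-- Nilpotency leaves finitely many powers, each with weight at most `N + 1`. -/
theorem re_inner_fejerSum_le {S : H →L[ℂ] H} {d : ℕ} (hS : S ^ d = 0) {N : ℕ} (hN : d ≤ N) {z : ℂ}
    (hz : ‖z‖ = 1) (y : H) :
    (⟪y, fejerSum N z S y⟫_ℂ).re ≤ (2 * ∑ n ∈ range d, ‖S ^ n‖ * ‖y‖ ^ 2) * (N + 1) := by
  have h0 : ∀ n, d ≤ n → S ^ n = 0 := fun n hn => pow_eq_zero_of_le hn hS
  rw [re_inner_fejerSum, sum_range_eq_of_forall_ge (d := d) (fun n hn => by simp [h0 n hn])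
    (by omega), mul_assoc, sum_mul]
  refine mul_le_mul_of_nonneg_left (sum_le_sum fun n hn => ?_) zero_le_two
  have h1 : ((starRingEnd ℂ z) ^ n * ⟪y, (S ^ n) y⟫_ℂ).re ≤ ‖S ^ n‖ * ‖y‖ ^ 2 := by
    refine (Complex.re_le_norm _).trans ?_
    rw [norm_mul, norm_pow, RCLike.norm_conj, hz, one_pow, one_mul]
    refine (norm_inner_le_norm _ _).trans ?_
    calc ‖y‖ * ‖(S ^ n) y‖ ≤ ‖y‖ * (‖S ^ n‖ * ‖y‖) := by gcongr; exact le_opNorm _ _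
      _ = _ := by ring
  have h2 : (n : ℝ) ≤ N := by
    exact_mod_cast (mem_range.1 hn).le.trans hN
  have h3 : (0 : ℝ) ≤ n := n.cast_nonneg
  calc (N + 1 - n : ℝ) * ((starRingEnd ℂ z) ^ n * ⟪y, (S ^ n) y⟫_ℂ).re
      ≤ (N + 1 - n : ℝ) * (‖S ^ n‖ * ‖y‖ ^ 2) :=
        mul_le_mul_of_nonneg_left h1 (by linarith)
    _ ≤ (N + 1 : ℝ) * (‖S ^ n‖ * ‖y‖ ^ 2) :=
        mul_le_mul_of_nonneg_right (by linarith) (by positivity)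
    _ = _ := mul_comm _ _

/-- If a polynomial curve `z ↦ ∑ zʲ kⱼ` lies in the kernel of the Poisson-type kernel of a nilpotent
operator `S`, then it lies in the kernel of that of every `2`-contraction `T` dominated by `S`:
all its Fourier coefficients vanish. -/
theorem HarnackDominated.fourier_coeff_eq_zero {T S : H →L[ℂ] H} (hT : IsRhoContraction 2 T)
    (hTS : HarnackDominated 2 T S) {d : ℕ} (hS : S ^ d = 0) (k : ℕ → H) (α : ℕ → ℝ)
    (hα : ∀ (z : ℂ) (n : ℕ), ‖z‖ = 1 → ((starRingEnd ℂ z) ^ n *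
      ⟪∑ j ∈ range d, z ^ j • k j, (S ^ n) (∑ j ∈ range d, z ^ j • k j)⟫_ℂ).re = α n)
    (hsum : ∑ n ∈ range d, α n = 0) (m : ℕ) (hm : m < d) :
    ∑ n ∈ range d, ∑ j ∈ range d, ((if j = m + n then (T ^ n) (k j) else 0) +
      (if j + n = m then ((star T) ^ n) (k j) else 0)) = 0 := by
  obtain ⟨c, hc⟩ := hTS.fejerSum_le
  refine ext_inner_left ℂ fun y => ?_
  rw [inner_zero_right]
  set w : ℕ → ℂ := fun n => ∑ j ∈ range d, ((if j = m + n then ⟪y, (T ^ n) (k j)⟫_ℂ else 0) +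
      (if j + n = m then ⟪y, ((star T) ^ n) (k j)⟫_ℂ else 0)) with hw
  -- For `0 ≤ m < d` only the powers `n < d` of `T` and `T*` meet the exponent `m`, so `T` itself
  -- need not be known to be nilpotent.
  have hw0 : ∀ n, d ≤ n → w n = 0 := fun n hn => sum_eq_zero fun j hj => by
    rw [if_neg (by have := mem_range.1 hj; omega), if_neg (by omega), add_zero]
  have hL : ⟪y, ∑ n ∈ range d, ∑ j ∈ range d, ((if j = m + n then (T ^ n) (k j) else 0) +
      (if j + n = m then ((star T) ^ n) (k j) else 0))⟫_ℂ = ∑ n ∈ range d, w n := by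
    simp only [inner_sum, inner_add_right, hw, apply_ite (fun x => ⟪y, x⟫_ℂ), inner_zero_right]
  rw [hL]
  refine eq_zero_of_norm_sq_le_linear d _ (∑ n ∈ range d, (n : ℂ) * w n)
    (c ^ 2 * (2 * ∑ n ∈ range d, ‖S ^ n‖ * ‖y‖ ^ 2) *
      (c ^ 2 * (-2 * ∑ n ∈ range d, n * α n))) fun N hN => ?_
  have hα0 : ∀ n, d ≤ n → α n = 0 := fun n hn => by
    rw [← hα 1 n norm_one, pow_eq_zero_of_le hn hS]; simp
  set Q : ℝ := c ^ 2 * (2 * ∑ n ∈ range d, ‖S ^ n‖ * ‖y‖ ^ 2) *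
      (c ^ 2 * (-2 * ∑ n ∈ range d, n * α n)) * (N + 1) with hQ
  have hbound : ∀ z : ℂ, ‖z‖ = 1 →
      ‖⟪y, fejerSum N z T (∑ j ∈ range d, z ^ j • k j)⟫_ℂ‖ ^ 2 ≤ Q := by
    intro z hz
    have hpos := hT.fejerSum_nonneg N hz
    have hnn : ∀ x : H, 0 ≤ (⟪x, fejerSum N z T x⟫_ℂ).re := fun x =>
      ((nonneg_iff_isPositive _).1 hpos).re_inner_nonneg_right x
    have hle : ∀ x : H, (⟪x, fejerSum N z T x⟫_ℂ).re ≤ c ^ 2 * (⟪x, fejerSum N z S x⟫_ℂ).re := by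
      intro x
      have := re_inner_le_of_le (hc N z hz) x
      rwa [smul_apply, inner_smul_right_eq_smul, Complex.smul_re, smul_eq_mul] at this
    have h1 := (hle y).trans
      (mul_le_mul_of_nonneg_left (re_inner_fejerSum_le hS hN hz y) (sq_nonneg c))
    have h2 := hle (∑ j ∈ range d, z ^ j • k j)
    -- The multiple of `N + 1` disappears because `∑ α n = 0`; what remains does not depend on `N`.
    have h3 : (⟪∑ j ∈ range d, z ^ j • k j,
        fejerSum N z S (∑ j ∈ range d, z ^ j • k j)⟫_ℂ).re = -2 * ∑ n ∈ range d, n * α n := by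
      rw [re_inner_fejerSum]
      simp only [hα z _ hz]
      rw [sum_range_eq_of_forall_ge (d := d) (fun n hn => by simp [hα0 n hn]) (by omega)]
      simp only [sub_mul, sum_sub_distrib, ← mul_sum, hsum]
      ring
    rw [h3] at h2
    refine (norm_inner_sq_le_of_nonneg hpos _ y).trans
      ((mul_le_mul h1 h2 (hnn _) ((hnn y).trans h1)).trans (le_of_eq ?_))
    rw [hQ]; ring
  -- The Boolean index separates `Tⁿ`, of exponent `j - n`, from `T*ⁿ`, of exponent `j + n`.
  have hexp : ∀ z : ℂ, ‖z‖ = 1 → ⟪y, fejerSum N z T (∑ j ∈ range d, z ^ j • k j)⟫_ℂ =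
      ∑ i ∈ (range (N + 1) ×ˢ range d) ×ˢ (univ : Finset Bool),
        (((N + 1 - i.1.1 : ℝ) : ℂ) * (if i.2 then ⟪y, (T ^ i.1.1) (k i.1.2)⟫_ℂ
          else ⟪y, ((star T) ^ i.1.1) (k i.1.2)⟫_ℂ)) *
        z ^ (if i.2 then (i.1.2 : ℤ) - i.1.1 else (i.1.2 : ℤ) + i.1.1) := by
    intro z hz
    have hz0 : z ≠ 0 := norm_ne_zero_iff.1 (by rw [hz]; exact one_ne_zero)
    have hzc : starRingEnd ℂ z = z⁻¹ := (Complex.inv_eq_conj hz).symm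
    rw [sum_product, sum_product]
    simp only [fejerSum, _root_.sum_apply, inner_sum, map_sum]
    rw [sum_comm]
    refine sum_congr rfl fun n _ => sum_congr rfl fun j _ => ?_
    rw [Fintype.sum_bool]
    simp only [smul_apply, add_apply, inner_smul_right, inner_add_right, map_smul, hzc, if_true,
      Bool.false_eq_true, if_false, zpow_sub₀ hz0, zpow_add₀ hz0, zpow_natCast]
    rw [inv_pow]
    ring
  have hfin := norm_sum_filter_le_of_laurent_bound _ _ _
    (fun z hz => (hexp z hz) ▸ Real.le_sqrt_of_sq_le (hbound z hz)) (m : ℤ)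
  have hQ0 : 0 ≤ Q := (sq_nonneg _).trans (hbound 1 norm_one)
  have hsumeq : ∑ i ∈ (range (N + 1) ×ˢ range d) ×ˢ (univ : Finset Bool) with
      (if i.2 then (i.1.2 : ℤ) - i.1.1 else (i.1.2 : ℤ) + i.1.1) = (m : ℤ),
        (((N + 1 - i.1.1 : ℝ) : ℂ) * (if i.2 then ⟪y, (T ^ i.1.1) (k i.1.2)⟫_ℂ
          else ⟪y, ((star T) ^ i.1.1) (k i.1.2)⟫_ℂ)) =
      ((N + 1 : ℝ) : ℂ) * ∑ n ∈ range d, w n - ∑ n ∈ range d, (n : ℂ) * w n := by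
    rw [mul_sum, ← sum_sub_distrib, ← sum_range_eq_of_forall_ge (d := d) (n := N + 1)
      (fun n hn => by simp [hw0 n hn]) (by omega), sum_filter, sum_product, sum_product]
    refine sum_congr rfl fun n _ => ?_
    rw [← sub_mul]
    simp only [hw]
    rw [mul_sum]
    refine sum_congr rfl fun j _ => ?_
    rw [Fintype.sum_bool]
    have e1 : ((j : ℤ) - n = m) ↔ j = m + n := by omega
    have e2 : ((j : ℤ) + n = m) ↔ j + n = m := by omega
    simp only [if_true, Bool.false_eq_true, if_false, e1, e2, mul_add, mul_ite, mul_zero]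
    push_cast
    rfl
  rw [hsumeq] at hfin
  calc _ ≤ √Q ^ 2 := by gcongr
    _ = Q := Real.sq_sqrt hQ0

end KernelCurve

/-! ### Weighted shifts and the numerical radius of `S`. -/

section WeightedShift

theorem weightedShift_apply (a b c d : ℂ) (x : EuclideanSpace ℂ (Fin 5)) :
    weightedShift a b c d x = !₂[a * x 1, b * x 2, c * x 3, d * x 4, 0] := by
  ext i
  rw [weightedShift, Matrix.ofLp_toEuclideanCLM]
  fin_cases i <;> simp [Matrix.mulVec, dotProduct, Fin.sum_univ_five]

theorem smul_weightedShift (s a b c d : ℂ) :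
    s • weightedShift a b c d = weightedShift (s * a) (s * b) (s * c) (s * d) := by
  ext x i
  rw [smul_apply, weightedShift_apply, weightedShift_apply]
  fin_cases i <;> simp [mul_assoc]

theorem weightedShift_pow_five (a b c d : ℂ) : weightedShift a b c d ^ 5 = 0 := by
  ext x i
  simp only [FunLike.coe_pow_eq_iterate, Function.iterate_succ, Function.iterate_zero,
    Function.comp_apply, id, weightedShift_apply]
  fin_cases i <;> simp

theorem nilpotencyClass_weightedShift {a b c d : ℂ} (ha : a ≠ 0) (hb : b ≠ 0) (hc : c ≠ 0)
    (hd : d ≠ 0) : nilpotencyClass (weightedShift a b c d) = 5 := by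
  refine nilpotencyClass_eq_succ_iff.2 ⟨weightedShift_pow_five a b c d, fun h => ?_⟩
  have h1 := congrArg (fun A : EuclideanSpace ℂ (Fin 5) →L[ℂ] EuclideanSpace ℂ (Fin 5) =>
    A (EuclideanSpace.single 4 1) 0) h
  simp [weightedShift_apply, ha, hb, hc, hd] at h1

theorem eq_weightedShift_of_apply_single {T : EuclideanSpace ℂ (Fin 5) →L[ℂ] EuclideanSpace ℂ (Fin 5)}
    {a b c d : ℂ} (h0 : T (EuclideanSpace.single 0 1) = 0)
    (h1 : T (EuclideanSpace.single 1 1) = a • EuclideanSpace.single 0 1)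
    (h2 : T (EuclideanSpace.single 2 1) = b • EuclideanSpace.single 1 1)
    (h3 : T (EuclideanSpace.single 3 1) = c • EuclideanSpace.single 2 1)
    (h4 : T (EuclideanSpace.single 4 1) = d • EuclideanSpace.single 3 1) :
    T = weightedShift a b c d := by
  ext x i
  have hx : x = ∑ i, x i • EuclideanSpace.single i (1 : ℂ) := by
    ext j; simp [Fin.sum_univ_five]; fin_cases j <;> simp
  conv_lhs => rw [hx]
  rw [weightedShift_apply, map_sum]
  simp only [map_smul, Fin.sum_univ_five, h0, h1, h2, h3, h4]
  fin_cases i <;> simp [mul_comm]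

theorem norm_le_norm_weightedShift (a b c d : ℂ) : ‖a‖ ≤ ‖weightedShift a b c d‖ := by
  have h := (weightedShift a b c d).le_opNorm (EuclideanSpace.single 1 1)
  have h2 : weightedShift a b c d (EuclideanSpace.single 1 1) = EuclideanSpace.single 0 a := by
    rw [weightedShift_apply]; ext i; fin_cases i <;> simp
  simpa [h2] using h

theorem one_div_cos_pi_div_six : 1 / Real.cos (Real.pi / 6) = 2 / √3 := by
  rw [Real.cos_pi_div_six, one_div_div]

theorem truncatedShift_eq : truncatedShift = weightedShift ((2 / √3 : ℝ) : ℂ) ((2 / √3 : ℝ) : ℂ)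
    ((2 / √3 : ℝ) : ℂ) ((2 / √3 : ℝ) : ℂ) := by
  rw [truncatedShift, one_div_cos_pi_div_six, smul_weightedShift]
  simp only [mul_one]

theorem norm_truncatedShift_le : ‖truncatedShift‖ ≤ 2 / √3 := by
  refine ContinuousLinearMap.opNorm_le_bound _ (by positivity) fun x => ?_
  refine abs_le_of_sq_le_sq' ?_ (by positivity) |>.2
  rw [truncatedShift_eq, weightedShift_apply, mul_pow, EuclideanSpace.norm_sq_eq,
    EuclideanSpace.norm_sq_eq, Fin.sum_univ_five, Fin.sum_univ_five]
  have h : ‖((2 / √3 : ℝ) : ℂ)‖ = 2 / √3 := by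
    rw [Complex.norm_real, Real.norm_of_nonneg (by positivity)]
  simp only [norm_mul, mul_pow, h, Matrix.cons_val]
  have := mul_nonneg (sq_nonneg (2 / √3)) (sq_nonneg ‖x 0‖)
  simp only [norm_zero]
  nlinarith

theorem numericalRadius_truncatedShift : numericalRadius truncatedShift = 1 := by
  have h3 : √3 * √3 = 3 := Real.mul_self_sqrt (by norm_num)
  have h3' : (0 : ℝ) < √3 := by positivity
  have hs : 2 / √3 = 2 / 3 * √3 := by field_simp; linarith
  -- The maximizer has entries proportional to `sin (jπ/6)`, `1 ≤ j ≤ 5`: it is the eigenvector of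
  -- `Re S` for the eigenvalue 1.
  refine IsGreatest.csSup_eq ⟨⟨(√12⁻¹ : ℂ) • !₂[1, (√3 : ℂ), 2, (√3 : ℂ), 1], ?_, ?_⟩, ?_⟩
  · rw [← sq_eq_sq₀ (norm_nonneg _) zero_le_one, norm_smul, mul_pow, EuclideanSpace.norm_sq_eq,
      Fin.sum_univ_five]
    simp
    norm_num
  · have hc : ((√3 : ℝ) : ℂ) ^ 2 = 3 := by rw [sq]; exact_mod_cast h3
    rw [truncatedShift_eq, hs, map_smul, inner_smul_left, inner_smul_right, ← mul_assoc,
      weightedShift_apply, PiLp.inner_apply, Fin.sum_univ_five]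
    simp only [Matrix.cons_val]
    have h12 : √12 * √12 = 12 := Real.mul_self_sqrt (by norm_num)
    simp
    rw [← mul_inv, abs_of_nonneg (Real.sqrt_nonneg _), h12]
    simp only [map_ofNat]
    rw [show ∀ v : ℂ, v = 12 → ‖v‖ = 12 from fun v hv => by rw [hv]; norm_num]
    · norm_num
    · linear_combination 4 * hc
  · rintro _ ⟨x, hx, rfl⟩
    have hx2 : ‖x‖ ^ 2 = 1 := by rw [hx, one_pow]
    rw [EuclideanSpace.norm_sq_eq, Fin.sum_univ_five] at hx2
    rw [truncatedShift_eq, hs, weightedShift_apply, PiLp.inner_apply, Fin.sum_univ_five]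
    have hn : ‖((2 / 3 * √3 : ℝ) : ℂ)‖ = 2 / 3 * √3 := by
      rw [Complex.norm_real, Real.norm_of_nonneg (by positivity)]
    have hle : ∀ u v : ℂ, ‖⟪((2 / 3 * √3 : ℝ) : ℂ) * u, v⟫_ℂ‖ ≤ 2 / 3 * √3 * ‖u‖ * ‖v‖ :=
      fun u v => (norm_inner_le_norm _ _).trans (by rw [norm_mul, hn])
    simp only [Matrix.cons_val, inner_zero_left, add_zero]
    refine (norm_add₄_le).trans ((add_le_add (add_le_add (add_le_add (hle _ _) (hle _ _))
      (hle _ _)) (hle _ _)).trans ?_)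
    rw [← hx2]
    -- The ratios are those of the maximizer's entries, so all four squares vanish there.
    have e1 := sq_nonneg (‖x 0‖ - √3 / 3 * ‖x 1‖)
    have e2 := sq_nonneg (‖x 1‖ - √3 / 2 * ‖x 2‖)
    have e3 := sq_nonneg (‖x 3‖ - √3 / 2 * ‖x 2‖)
    have e4 := sq_nonneg (‖x 4‖ - √3 / 3 * ‖x 3‖)
    have f : ∀ t : ℝ, √3 * √3 * t = 3 * t := fun t => by rw [h3]
    nlinarith [f (‖x 1‖ ^ 2), f (‖x 2‖ ^ 2), f (‖x 3‖ ^ 2)]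

theorem truncatedShift_unitarily_equivalent {u : ℂ} (hu : ‖u‖ = 1) :
    ∃ U ∈ unitary (EuclideanSpace ℂ (Fin 5) →L[ℂ] EuclideanSpace ℂ (Fin 5)),
      ((2 / √3 : ℝ) : ℂ) • weightedShift 1 u (starRingEnd ℂ u) 1 =
        star U * truncatedShift * U := by
  have huu : u * starRingEnd ℂ u = 1 := by
    rw [Complex.mul_conj, Complex.normSq_eq_norm_sq, hu]; simp
  have huu' : starRingEnd ℂ u * u = 1 := by rw [mul_comm, huu]
  -- Conjugation multiplies the weight at `(i, i + 1)` by `conj dᵢ * dᵢ₊₁`, that is by `1, u, ū, 1`.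
  set D : Matrix (Fin 5) (Fin 5) ℂ := Matrix.diagonal ![1, 1, u, 1, 1] with hD
  have hDs : star D = Matrix.diagonal ![1, 1, starRingEnd ℂ u, 1, 1] := by
    rw [hD, Matrix.star_eq_conjTranspose, Matrix.diagonal_conjTranspose]
    congr 1
    ext i; fin_cases i <;> simp
  refine ⟨Matrix.toEuclideanCLM (n := Fin 5) (𝕜 := ℂ) D, ?_, ?_⟩
  · rw [Unitary.mem_iff, ← map_star, ← map_mul, ← map_mul, hDs, hD, Matrix.diagonal_mul_diagonal,
      Matrix.diagonal_mul_diagonal]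
    have h1 : ∀ v w : ℂ, v * w = 1 →
        (Matrix.diagonal fun i => (![1, 1, v, 1, 1] : Fin 5 → ℂ) i * ![1, 1, w, 1, 1] i) = 1 := by
      intro v w h
      rw [← Matrix.diagonal_one]
      congr 1
      ext i; fin_cases i <;> simp [h]
    rw [h1 _ _ huu, h1 _ _ huu', map_one]
    exact ⟨rfl, rfl⟩
  · rw [← map_star, hDs]
    rw [truncatedShift, one_div_cos_pi_div_six, mul_smul_comm, smul_mul_assoc]
    congr 1
    ext x i
    rw [mul_apply_eq_comp, mul_apply_eq_comp, Matrix.ofLp_toEuclideanCLM, weightedShift_apply,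
      weightedShift_apply, Matrix.ofLp_toEuclideanCLM, hD]
    fin_cases i <;> simp [Matrix.mulVec_diagonal]

end WeightedShift

/-! ### The kernel curve of `S` and its recurrence. -/

section KernelEquations

open Finset

/-- The coefficients of the polynomial curve spanning the kernels for the truncated shift. -/
noncomputable def kernelCurve : ℕ → EuclideanSpace ℂ (Fin 5)
  | 1 => EuclideanSpace.single 0 (-(√3 : ℂ))
  | 2 => EuclideanSpace.single 1 (-1)
  | 4 => EuclideanSpace.single 3 1
  | 5 => EuclideanSpace.single 4 (√3 : ℂ)
  | _ => 0

theorem sum_kernelCurve (z : ℂ) : ∑ j ∈ range 7, z ^ j • kernelCurve j =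
    !₂[-(√3 : ℂ) * z, -z ^ 2, 0, z ^ 4, (√3 : ℂ) * z ^ 5] := by
  ext i
  fin_cases i <;> simp [sum_range_succ, kernelCurve] <;> ring

/-- Coordinate `i` of the curve is a multiple of `z ^ (i + 1)`, so the factor `z̄ⁿ` offsets the
shift by `n` and the value is free of `z`. The five listed values sum to zero; the default 0 covers
`n ≥ 5`, where the power vanishes. -/
theorem re_inner_kernelCurve (z : ℂ) (n : ℕ) (hz : ‖z‖ = 1) : ((starRingEnd ℂ z) ^ n *
      ⟪∑ j ∈ range 7, z ^ j • kernelCurve j,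
        (truncatedShift ^ n) (∑ j ∈ range 7, z ^ j • kernelCurve j)⟫_ℂ).re =
      ([8, 4, -4 / 3, -16 / 3, -16 / 3] : List ℝ).getD n 0 := by
  have hr : (√3 : ℂ) ^ 2 = 3 := by
    exact_mod_cast Real.sq_sqrt (show (0 : ℝ) ≤ 3 by norm_num)
  have hs : ((2 / √3 : ℝ) : ℂ) = 2 / 3 * (√3 : ℂ) := by
    have : (√3 : ℂ) ≠ 0 := fun h => by simp [h] at hr
    push_cast
    field_simp
    linear_combination -hr
  have hz0 : z ≠ 0 := norm_ne_zero_iff.1 (by rw [hz]; exact one_ne_zero)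
  have hzc : starRingEnd ℂ z = z⁻¹ := (Complex.inv_eq_conj hz).symm
  rcases lt_or_ge n 5 with hn | hn
  · have hre : ∀ (w : ℂ) (t : ℝ), w = t → w.re = t := fun w t h => by rw [h, Complex.ofReal_re]
    rw [sum_kernelCurve, truncatedShift_eq, hs]
    apply hre
    interval_cases n <;>
    simp [-inner_self_eq_norm_sq_to_K, weightedShift_apply, PiLp.inner_apply, Fin.sum_univ_five,
      hzc] <;> field_simp <;> ring_nf
    · linear_combination 2 * hr
    · linear_combination 4 * hr
    · linear_combination -4 * hr
    · linear_combination -16 * ((√3 : ℂ) ^ 2 + 3) * hr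
    · linear_combination -16 * ((√3 : ℂ) ^ 4 + 3 * (√3 : ℂ) ^ 2 + 9) * hr
  · rw [truncatedShift_eq, pow_eq_zero_of_le hn (weightedShift_pow_five _ _ _ _),
      List.getD_eq_default _ _ (by simpa using hn)]
    simp

/-- The vector equations solved by an operator all of whose kernels contain the kernel curve. -/
theorem exists_recurrence_of_fourier_coeff {E : Type*} [AddCommGroup E] [Module ℂ E]
    (T R : E →ₗ[ℂ] E) (k₀ k₁ k₃ k₄ : E)
    (h0 : T k₀ + T (T k₁) + T (T (T (T k₃))) + T (T (T (T (T k₄)))) = 0)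
    (h1 : (2 : ℂ) • k₀ + T k₁ + T (T (T k₃)) + T (T (T (T k₄))) = 0)
    (h2 : R k₀ + (2 : ℂ) • k₁ + T (T k₃) + T (T (T k₄)) = 0)
    (h3 : R (R k₀) + R k₁ + T k₃ + T (T k₄) = 0)
    (h4 : R (R (R k₀)) + R (R k₁) + (2 : ℂ) • k₃ + T k₄ = 0)
    (h5 : R (R (R (R k₀))) + R (R (R k₁)) + R k₃ + (2 : ℂ) • k₄ = 0)
    (h6 : R (R (R (R (R k₀)))) + R (R (R (R k₁))) + R (R k₃) + R k₄ = 0) :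
    ∃ a b c : E, T k₀ = 0 ∧ T a = (2 : ℂ) • k₀ ∧ T c = a + k₁ ∧ T b = -c ∧ T k₄ = b - k₃ ∧
      R k₄ = 0 ∧ R b = (2 : ℂ) • k₄ ∧ R c = -(b + k₃) ∧ R a = c ∧ R k₀ = a - k₁ := by
  -- Toeplitz structure: `T` applied to one equation has the same `T`-tail as the equation before
  -- it, so the difference is short. The same works with `R` from the other end.
  have t1 := congrArg T h1
  have t2 := congrArg T h2
  have r3 := congrArg T h3
  have r4 := congrArg R h4
  have r5 := congrArg R h5
  simp only [map_add, map_smul, map_zero] at t1 t2 r3 r4 r5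
  refine ⟨k₁ + R k₀, k₃ + T k₄, R k₁ + R (R k₀), ?_, ?_, ?_, ?_, ?_, ?_, ?_, ?_, map_add R _ _, ?_⟩
  · linear_combination (norm := module) t1 - h0
  · rw [map_add]; linear_combination (norm := module) t2 - h1
  · rw [map_add]; linear_combination (norm := module) r3 - h2
  · rw [map_add]; linear_combination (norm := module) h3
  · module
  · linear_combination (norm := module) r5 - h6
  · rw [map_add]; linear_combination (norm := module) r4 - h5
  · rw [map_add]; linear_combination (norm := module) h4
  · module

end KernelEquations

/-! ### Solving for the operator. -/

section Classification

open Finset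

theorem exists_recurrence_of_dominated
    {T : EuclideanSpace ℂ (Fin 5) →L[ℂ] EuclideanSpace ℂ (Fin 5)}
    (hT : IsRhoContraction 2 T) (hTS : HarnackDominated 2 T truncatedShift) :
    ∃ a b c : EuclideanSpace ℂ (Fin 5), T (kernelCurve 1) = 0 ∧ T a = (2 : ℂ) • kernelCurve 1 ∧
      T c = a + kernelCurve 2 ∧ T b = -c ∧ T (kernelCurve 5) = b - kernelCurve 4 ∧
      star T (kernelCurve 5) = 0 ∧ star T b = (2 : ℂ) • kernelCurve 5 ∧
      star T c = -(b + kernelCurve 4) ∧ star T a = c ∧ star T (kernelCurve 1) = a - kernelCurve 2 := by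
  -- The exponent 7 admits the coefficients `m = 0, …, 6`, one beyond each end of the curve's
  -- degrees 1 to 5.
  have h5 : truncatedShift ^ 7 = 0 :=
    pow_eq_zero_of_le (by norm_num : 5 ≤ 7) (truncatedShift_eq ▸ weightedShift_pow_five _ _ _ _)
  have key := hTS.fourier_coeff_eq_zero hT h5 kernelCurve _ re_inner_kernelCurve
    (by simp [sum_range_succ]; norm_num)
  have k0 : kernelCurve 0 = 0 := rfl
  have k3 : kernelCurve 3 = 0 := rfl
  have k6 : kernelCurve 6 = 0 := rfl
  have e0 := key 0 (by norm_num)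
  have e1 := key 1 (by norm_num)
  have e2 := key 2 (by norm_num)
  have e3 := key 3 (by norm_num)
  have e4 := key 4 (by norm_num)
  have e5 := key 5 (by norm_num)
  have e6 := key 6 (by norm_num)
  simp [sum_range_succ, k0, k3, k6] at e0 e1 e2 e3 e4 e5 e6
  refine exists_recurrence_of_fourier_coeff (T : EuclideanSpace ℂ (Fin 5) →ₗ[ℂ] _)
    (star T : EuclideanSpace ℂ (Fin 5) →L[ℂ] _) _ _ _ _ ?_ ?_ ?_ ?_ ?_ ?_ ?_ <;>
  simp only [ContinuousLinearMap.coe_coe]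
  · linear_combination (norm := module) e0
  · linear_combination (norm := module) e1
  · linear_combination (norm := module) e2
  · linear_combination (norm := module) e3
  · linear_combination (norm := module) e4
  · linear_combination (norm := module) e5
  · linear_combination (norm := module) e6

/-- The two weighted shifts solving the recurrence, up to the phase of the middle weights. -/
theorem eq_weightedShift_of_recurrence
    {T : EuclideanSpace ℂ (Fin 5) →L[ℂ] EuclideanSpace ℂ (Fin 5)} {a b c : EuclideanSpace ℂ (Fin 5)}
    (hTk0 : T (kernelCurve 1) = 0) (hTa : T a = (2 : ℂ) • kernelCurve 1)
    (hTc : T c = a + kernelCurve 2) (hTb : T b = -c) (hTk4 : T (kernelCurve 5) = b - kernelCurve 4)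
    (hRk4 : star T (kernelCurve 5) = 0) (hRb : star T b = (2 : ℂ) • kernelCurve 5)
    (hRc : star T c = -(b + kernelCurve 4)) (hRa : star T a = c)
    (hRk0 : star T (kernelCurve 1) = a - kernelCurve 2) :
    (∃ x : ℂ, ‖x‖ ^ 2 = 12 ∧ T = weightedShift (2 / 3 * (√3 : ℂ)) (-4 / x) (-x / 3)
      (2 / 3 * (√3 : ℂ))) ∨
    (∃ x : ℂ, ‖x‖ ^ 2 = 2 ∧ T = weightedShift (-(√3 : ℂ)) (1 / x) (x / 2) (-(√3 : ℂ))) := by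
  have hr : (√3 : ℂ) ^ 2 = 3 := by
    exact_mod_cast Real.sq_sqrt (show (0 : ℝ) ≤ 3 by norm_num)
  have hr0 : (√3 : ℂ) ≠ 0 := fun h => by simp [h] at hr
  have adj : ∀ x y, ⟪T x, y⟫_ℂ = ⟪x, star T y⟫_ℂ := fun x y => by
    rw [ContinuousLinearMap.star_eq_adjoint, ContinuousLinearMap.adjoint_inner_right]
  -- The relations `i1` to `i6` kill coordinates 0 and 4 of `a`, `b`, `c`; the rest reduce these
  -- vectors to multiples of `e₁`, `e₃`, `e₂`.
  have i1 := adj (kernelCurve 1) c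
  have i2 := adj (kernelCurve 1) a
  have i3 := adj (kernelCurve 1) (kernelCurve 1)
  have i4 := adj (kernelCurve 5) (kernelCurve 5)
  have i5 := adj b (kernelCurve 5)
  have i6 := adj c (kernelCurve 5)
  have i7 := adj c (kernelCurve 1)
  have i8 := adj c c
  have i9 := adj a a
  have i10 := adj b b
  have j1 := adj a (kernelCurve 1)
  have j2 := adj c a
  have j3 := adj (kernelCurve 5) b
  have j4 := adj b c
  have j5 := adj a c
  have j6 := adj c b
  have j7 := adj b (kernelCurve 1)
  rw [hTk0] at i1 i2 i3
  rw [hTk4] at i4 j3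
  rw [hTb] at i5 i10 j4 j7
  rw [hTc] at i6 i7 i8 j2 j6
  rw [hTa] at i9 j1 j5
  rw [hRc] at i1 i8 j4 j5
  rw [hRa] at i2 i9 j2
  rw [hRk0] at i3 i7 j1 j7
  rw [hRk4] at i4 i5 i6
  rw [hRb] at i10 j3 j6
  simp [PiLp.inner_apply, Fin.sum_univ_five, kernelCurve, -inner_self_eq_norm_sq_to_K, hr0] at i1 i2 i3 i4 i5 i6 i7 i8 i9 i10 j1 j2 j3 j4 j5 j6 j7
  simp only [i1, i2, i3, i4, i5, i6, map_zero, mul_zero, zero_mul, add_zero, zero_add,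
    neg_zero] at i7 i8 i9 i10 j1 j2 j3 j4 j5 j6 j7
  have i7' := congrArg (starRingEnd ℂ) i7
  have i8' := congrArg (starRingEnd ℂ) i8
  have i10' := congrArg (starRingEnd ℂ) i10
  have j5' := congrArg (starRingEnd ℂ) j5
  have j7' := congrArg (starRingEnd ℂ) j7
  simp only [map_add, map_neg, map_mul, map_zero, Complex.conj_conj] at i7' i8' i10' j5' j7'
  have c1 : c 1 = 0 := by linear_combination i9 - i7'
  simp only [c1, map_zero, mul_zero, zero_mul, add_zero, zero_add, neg_zero] at i8' i9 i10 i10' j2 j4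
  have c3 : c 3 = 0 := by
    have h := congrArg (starRingEnd ℂ) i9
    simp only [map_add, map_mul, map_zero, Complex.conj_conj] at h
    linear_combination i8' + i10' + h
  simp only [c3, map_zero, mul_zero, zero_mul, add_zero, zero_add, neg_zero] at i9 i10 j2 j4
  have b1 : b 1 = 0 := by linear_combination -(j7' + j6) / 2
  have a3 : a 3 = 0 := by
    have h := congrArg (starRingEnd ℂ) j6
    simp only [map_add, map_neg, map_mul, map_zero, Complex.conj_conj, b1] at h
    simp only [b1, map_zero] at j5'
    linear_combination j5' - h
  simp only [b1, a3, map_zero, mul_zero, add_zero, zero_add, neg_zero] at i9 i10 j1 j2 j3 j4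
  have j1' := congrArg (starRingEnd ℂ) j1
  have j3' := congrArg (starRingEnd ℂ) j3
  simp only [map_add, map_sub, map_mul, map_ofNat, Complex.conj_conj,
    Complex.conj_ofReal] at j1' j3'
  have hA : starRingEnd ℂ (a 1) = a 1 := by linear_combination j1' - j1
  have hB : starRingEnd ℂ (b 3) = b 3 := by linear_combination j3 - j3'
  -- Otherwise `j1` and `j2` force `a 1 = 3` and `|a 2|² = -6`.
  have hc2 : c 2 ≠ 0 := by
    intro h
    have h3 : a 1 = 3 := by
      simp only [h, hA, map_zero, mul_zero] at j1 j2
      linear_combination -(j1 + j2) / 2 + hr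
    rw [hA, h3, Complex.mul_conj] at j1
    have h4 : Complex.normSq (a 2) = -6 := by
      have : (Complex.normSq (a 2) : ℂ) = ((-6 : ℝ) : ℂ) := by
        push_cast; linear_combination -j1 + 2 * hr
      exact_mod_cast this
    linarith [Complex.normSq_nonneg (a 2)]
  have a2 : a 2 = 0 := by simpa [hc2] using i9
  have b2 : b 2 = 0 := by simpa [hc2] using i10
  simp only [a2, b2, hA, hB, Complex.mul_conj, map_zero, mul_zero, add_zero, zero_add,
    neg_zero] at j1 j2 j3 j4
  have hT0 : T (EuclideanSpace.single 0 1) = 0 := by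
    have h : kernelCurve 1 = (-(√3 : ℂ)) • EuclideanSpace.single 0 (1 : ℂ) := by
      ext i; fin_cases i <;> simp [kernelCurve]
    rwa [h, map_smul, smul_eq_zero_iff_right (neg_ne_zero.2 hr0)] at hTk0
  have ha : a = a 1 • EuclideanSpace.single 1 (1 : ℂ) := by
    ext i; fin_cases i <;> simp [i3, a2, a3, i6]
  have hb : b = b 3 • EuclideanSpace.single 3 (1 : ℂ) := by
    ext i; fin_cases i <;> simp [i1, b1, b2, i4]
  have hc : c = c 2 • EuclideanSpace.single 2 (1 : ℂ) := by
    ext i; fin_cases i <;> simp [i2, c1, c3, i5]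
  have hk5 : kernelCurve 5 = (√3 : ℂ) • EuclideanSpace.single 4 (1 : ℂ) := by
    ext i; fin_cases i <;> simp [kernelCurve]
  have inv : ∀ {s : ℂ} {u v : EuclideanSpace ℂ (Fin 5)}, s ≠ 0 → T (s • u) = v → T u = s⁻¹ • v :=
    fun {s u v} hs h => by rw [← h, map_smul, inv_smul_smul₀ hs]
  have hA0 : (a 1 + 3) * (a 1 - 2) = 0 := by linear_combination -j1 + 2 * hr
  have hB0 : (b 3 - 3) * (b 3 + 2) = 0 := by linear_combination j3 + 2 * hr
  have hnorm : ∀ t : ℝ, (Complex.normSq (c 2) : ℂ) = t → ‖c 2‖ ^ 2 = t := fun t h => by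
    rw [← Complex.normSq_eq_norm_sq]; exact_mod_cast h
  have hA1 : a 1 ≠ 0 := fun h => by rw [h] at hA0; norm_num at hA0
  have hB1 : b 3 ≠ 0 := fun h => by rw [h] at hB0; norm_num at hB0
  have hT : T = weightedShift (-2 * (√3 : ℂ) / a 1) ((a 1 - 1) / c 2) (-c 2 / b 3)
      ((b 3 - 1) / (√3 : ℂ)) := by
    refine eq_weightedShift_of_apply_single hT0 ?_ ?_ ?_ ?_
    · rw [inv hA1 (ha ▸ hTa)]
      ext i; fin_cases i <;> simp [kernelCurve]
      ring
    · rw [inv hc2 (hc ▸ hTc)]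
      ext i; fin_cases i <;> simp [kernelCurve, i3, a2, a3, i6]
      ring
    · rw [inv hB1 (hb ▸ hTb)]
      ext i; fin_cases i <;> simp [i2, c1, c3, i5]
      ring
    · rw [inv hr0 (hk5 ▸ hTk4)]
      ext i; fin_cases i <;> simp [kernelCurve, i1, b1, b2, i4]
      ring
  -- By `j2` and `j4`, `|c 2|²` equals both `a₁² - a₁` and `b₃² + b₃`: 12 for the roots -3 and 3,
  -- but 2 for the roots 2 and -2. Mixed choices clash.
  rcases mul_eq_zero.1 hA0 with h1 | h1 <;> rcases mul_eq_zero.1 hB0 with h2 | h2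
  · have a1 : a 1 = -3 := by linear_combination h1
    have b3 : b 3 = 3 := by linear_combination h2
    rw [a1] at j2
    refine Or.inl ⟨c 2, hnorm 12 (by push_cast; linear_combination -j2), ?_⟩
    rw [hT, a1, b3]
    congr 1
    · ring
    · norm_num
    · field_simp; linear_combination -2 * hr
  · have a1 : a 1 = -3 := by linear_combination h1
    have b3 : b 3 = -2 := by linear_combination h2
    rw [a1] at j2
    rw [b3] at j4
    exact absurd (by linear_combination j2 - j4 : (10 : ℂ) = 0) (by norm_num)
  · have a1 : a 1 = 2 := by linear_combination h1
    have b3 : b 3 = 3 := by linear_combination h2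
    rw [a1] at j2
    rw [b3] at j4
    exact absurd (by linear_combination j4 - j2 : (10 : ℂ) = 0) (by norm_num)
  · have a1 : a 1 = 2 := by linear_combination h1
    have b3 : b 3 = -2 := by linear_combination h2
    rw [a1] at j2
    refine Or.inr ⟨c 2, hnorm 2 (by push_cast; linear_combination -j2), ?_⟩
    rw [hT, a1, b3]
    congr 1
    · ring
    · norm_num
    · ring
    · field_simp; linear_combination hr

theorem exists_eq_mul_exp_neg {x : ℂ} {r : ℝ} (h : ‖x‖ = r) :
    ∃ θ : ℝ, x = r * Complex.exp (-(θ * Complex.I)) := by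
  refine ⟨-Complex.arg x, ?_⟩
  rw [← h]
  conv_lhs => rw [← Complex.norm_mul_exp_arg_mul_I x]
  push_cast
  rw [neg_mul, neg_neg]

end Classification

theorem mainTheorem1 :
    1 / Real.cos (Real.pi / 6) = 2 / Real.sqrt 3 ∧
    numericalRadius truncatedShift = 1 ∧
    ∀ T : EuclideanSpace ℂ (Fin 5) →L[ℂ] EuclideanSpace ℂ (Fin 5),
      T ∈ harnackPart 2 truncatedShift →
      ((∃ θ : ℝ,
          T = ((2 / Real.sqrt 3 : ℝ) : ℂ) •
            weightedShift 1 (Complex.exp (θ * Complex.I)) (Complex.exp (-(θ * Complex.I))) 1 ∧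
          ∃ U ∈ unitary (EuclideanSpace ℂ (Fin 5) →L[ℂ] EuclideanSpace ℂ (Fin 5)),
            T = star U * truncatedShift * U) ∨
        (∃ θ : ℝ,
          T = weightedShift (-(Real.sqrt 3 : ℂ))
            (Complex.exp (θ * Complex.I) / (Real.sqrt 2 : ℂ))
            (Complex.exp (-(θ * Complex.I)) / (Real.sqrt 2 : ℂ)) (-(Real.sqrt 3 : ℂ)) ∧
          ‖truncatedShift‖ < ‖T‖)) ∧
      IsNilpotent T ∧ nilpotencyClass T = nilpotencyClass truncatedShift := by
  refine ⟨one_div_cos_pi_div_six, numericalRadius_truncatedShift, fun T ⟨hT, hTS, _⟩ => ?_⟩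
  have hr2 : √3 * √3 = 3 := Real.mul_self_sqrt (by norm_num)
  have hr : (√3 : ℂ) ^ 2 = 3 := by rw [sq]; exact_mod_cast hr2
  have hr0 : (√3 : ℂ) ≠ 0 := fun h => by simp [h] at hr
  have hs : ((2 / √3 : ℝ) : ℂ) = 2 / 3 * (√3 : ℂ) := by
    push_cast
    field_simp
    linear_combination -hr
  have hS0 : nilpotencyClass truncatedShift = 5 := by
    have : ((2 / √3 : ℝ) : ℂ) ≠ 0 := by rw [hs]; exact mul_ne_zero (by norm_num) hr0
    rw [truncatedShift_eq, nilpotencyClass_weightedShift this this this this]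
  obtain ⟨a, b, c, h1, h2, h3, h4, h5, h6, h7, h8, h9, h10⟩ := exists_recurrence_of_dominated hT hTS
  rw [hS0]
  rcases eq_weightedShift_of_recurrence h1 h2 h3 h4 h5 h6 h7 h8 h9 h10 with
    ⟨x, hx, hTx⟩ | ⟨x, hx, hTx⟩
  · have hx0 : x ≠ 0 := fun h => by simp [h] at hx
    -- The middle weights are `-4/x` and `-x/3`, so the phase is read off from `-x`.
    have hxn : ‖-x‖ = 2 * √3 := by
      rw [norm_neg, ← sq_eq_sq₀ (norm_nonneg _) (by positivity), hx]
      linarith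
    refine ⟨Or.inl ?_, ⟨5, hTx ▸ weightedShift_pow_five _ _ _ _⟩, ?_⟩
    · obtain ⟨θ, hθ⟩ := exists_eq_mul_exp_neg hxn
      have hT' : T = ((2 / √3 : ℝ) : ℂ) • weightedShift 1 (Complex.exp (θ * Complex.I))
          (Complex.exp (-(θ * Complex.I))) 1 := by
        rw [hTx, hs, smul_weightedShift, ← neg_neg x, hθ, Complex.exp_neg]
        have he := Complex.exp_ne_zero (θ * Complex.I)
        push_cast
        congr 1
        · ring
        · field_simp; linear_combination -4 * hr
        · ring
        · ring
      refine ⟨θ, hT', ?_⟩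
      have hc : Complex.exp (-(θ * Complex.I)) = starRingEnd ℂ (Complex.exp (θ * Complex.I)) := by
        rw [← Complex.exp_conj]; simp
      rw [hT', hc]
      exact truncatedShift_unitarily_equivalent (Complex.norm_exp_ofReal_mul_I θ)
    · rw [hTx, nilpotencyClass_weightedShift] <;> simp [hx0, hr0]
  · have hx0 : x ≠ 0 := fun h => by simp [h] at hx
    have hxn : ‖x‖ = √2 := by rw [← hx, Real.sqrt_sq (norm_nonneg _)]
    refine ⟨Or.inr ?_, ⟨5, hTx ▸ weightedShift_pow_five _ _ _ _⟩, ?_⟩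
    · obtain ⟨θ, hθ⟩ := exists_eq_mul_exp_neg hxn
      have h22 : (√2 : ℂ) ^ 2 = 2 := by
        exact_mod_cast Real.sq_sqrt (show (0 : ℝ) ≤ 2 by norm_num)
      have h20 : (√2 : ℂ) ≠ 0 := fun h => by simp [h] at h22
      refine ⟨θ, ?_, ?_⟩
      · rw [hTx, hθ, Complex.exp_neg]
        have he := Complex.exp_ne_zero (θ * Complex.I)
        congr 1
        · field_simp
        · field_simp; linear_combination h22
      · have h := norm_le_norm_weightedShift (-(√3 : ℂ)) (1 / x) (x / 2) (-(√3 : ℂ))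
        rw [norm_neg, Complex.norm_real, Real.norm_of_nonneg (Real.sqrt_nonneg _)] at h
        rw [hTx]
        -- `‖S‖ ≤ 2/√3 < √3 ≤ ‖T‖`, the last from the first weight.
        refine (norm_truncatedShift_le.trans_lt ?_).trans_le h
        rw [div_lt_iff₀ (by positivity), hr2]
        norm_num
    · rw [hTx, nilpotencyClass_weightedShift] <;> simp [hx0, hr0]
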